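/- Let $q$ be an odd prime power, let $\mathbb F_q$ be the field with $q$ elements, and let $\chi_q$ be the quadratic character of $\mathbb F_q^\times$, extended by $\chi_q(0)=0$. Let $m\ge 2$ be an integer with $\gcd(q-1,m(m-1))=2$. For a partition $\lambda=(\lambda_1,\dots,\lambda_k)$ of $m$ write $\ell(\lambda)=k$, and let $S_\lambda$ be the set of monic squarefree $f\in\mathbb F_q[x]$ with factorization type $\lambda$, that is, $f=\pi_1\cdots\pi_k$ with distinct monic irreducible $\pi_i\in\mathbb F_q[x]$ and $\deg\pi_i=\lambda_i$ for all $i$. For $S\subseteq\mathbb F_q[x]$ and $D\subseteq\mathbb F_q$, say that the discriminants of the polynomials in $S$ are equally distributed among the elements of $D$ if $\operatorname{disc}(f)\in D$ for every $f\in S$ and there is an integer $N\ge 0$ such that every $d\in D$ is the discriminant of exactly $N$ polynomials in $S$. Then: 1. Every element of $\mathbb F_q$ is the discriminant of exactly $q^{m-1}$ monic polynomials of degree $m$ in $\mathbb F_q[x]$. 2. For each sign $\varepsilon\in\{1,-1\}$ there are exactly $(q-1)/2$ elements $d\in\mathbb F_q$ with $\chi_q(d)=\varepsilon$. The set of monic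 irreducible polynomials of degree $m$ in $\mathbb F_q[x]$ is nonempty, and the discriminants of its elements are equally distributed among the $(q-1)/2$ elements $d$ with $\chi_q(d)=(-1)^{m-1}$; in particular, each such $d$ is the discriminant of the same positive number of monic irreducible polynomials of degree $m$. 3. For every partition $\lambda$ of $m$, the discriminants of the polynomials in $S_\lambda$ are equally distributed among the $(q-1)/2$ elements $d$ with $\chi_q(d)=(-1)^{m-\ell(\lambda)}$. (If $S_\lambda$ is empty then $N=0$; otherwise $N>0$.) -/

import Mathlib

open Polynomial

noncomputable section

/-- The monic polynomial `f ∈ K[x]` of degree `m` has factorization type `lam` (a partition of `m`):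
`f` is a product of distinct monic irreducibles whose degrees are the parts of `lam`,
counted with multiplicity. -/
def HasFactorizationType {K : Type*} [Field K] {m : ℕ} (f : K[X]) (lam : m.Partition) : Prop :=
  ∃ s : Finset K[X], (∀ p ∈ s, p.Monic ∧ Irreducible p) ∧
    f = ∏ p ∈ s, p ∧ s.val.map natDegree = lam.parts

/-- The set of monic polynomials of degree `m` in `K[x]`. -/
def monicsOfDegree (K : Type*) [Field K] (m : ℕ) : Set K[X] :=
  {f | f.Monic ∧ f.natDegree = m}

/-- The set of monic irreducible polynomials of degree `m` in `K[x]`. -/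
def monicIrreduciblesOfDegree (K : Type*) [Field K] (m : ℕ) : Set K[X] :=
  {f | f.Monic ∧ Irreducible f ∧ f.natDegree = m}

/-- The set `S_{lam,K}` of monic squarefree polynomials in `K[x]` with factorization type `lam`. -/
def monicsOfType (K : Type*) [Field K] {m : ℕ} (lam : m.Partition) : Set K[X] :=
  {f | f.Monic ∧ Squarefree f ∧ HasFactorizationType f lam}

/-- The discriminants of the polynomials in `S` are equally distributed among the elements of `D`:
they all lie in `D`, and every element of `D` is the discriminant of the same finite number `N` of
polynomials in `S`. (If `S` is nonempty then necessarily `N > 0`.) -/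
def DiscsEquallyDistributed {K : Type*} [Field K] (S : Set K[X]) (D : Set K) : Prop :=
  (∀ f ∈ S, f.discr ∈ D) ∧ ∃ N : ℕ, ∀ d ∈ D, {f ∈ S | f.discr = d}.encard = N

end

/-! Scaling the roots of a monic `f` of degree `m` by a unit `c` multiplies `disc f` by `c ^
(m(m-1))` (`discr_scaleRoots`). As `gcd(q-1, m(m-1)) = 2`, these factors run through all nonzero
squares, so in any scaling-stable set of such `f` the discriminant fibres over one quadratic class
have equal size (`encard_discr_fiber_eq`). Pellet–Stickelberger (`quadraticChar_discr_prod`) puts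
each factorization type in a single class, which settles the irreducible and fixed-type statements.
For all monics it also gives `χ(disc f) = (-1)^m μ(f)`; since `μ` sums to `0` in degree `m ≥ 2`, the
`q^m - q^(m-1)` squarefree polynomials split evenly between the two classes of `(q-1)/2` elements,
so each nonzero fibre has `q^(m-1)` members. The non-squarefree ones form the fibre over `0`. -/

/-! ### Discriminants of monic polynomials via resultants. -/

/-- Raising the formal degree only introduces powers of the leading coefficient of `f`. This matters
because `f'` can have degree below `deg f - 1` in positive characteristic. -/
theorem resultant_right_deg_eq_of_monic {R : Type*} [CommRing R] {f : R[X]} (hf : f.Monic)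
    (g : R[X]) {n : ℕ} (hn : g.natDegree ≤ n) : resultant f g f.natDegree n = resultant f g := by
  obtain ⟨k, rfl⟩ := Nat.exists_eq_add_of_le hn
  rw [resultant_add_right_deg _ _ _ _ _ le_rfl, hf.coeff_natDegree, one_pow, one_mul]

theorem resultant_mul_right_of_monic {R : Type*} [CommRing R] {f : R[X]} (hf : f.Monic)
    (g h : R[X]) : resultant f (g * h) = resultant f g * resultant f h := by
  rw [← resultant_right_deg_eq_of_monic hf (g * h) natDegree_mul_le,
    resultant_mul_right _ _ _ _ le_rfl]

theorem resultant_mul_left_of_monic {R : Type*} [CommRing R] {f g : R[X]} (hf : f.Monic)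
    (hg : g.Monic) (h : R[X]) : resultant (f * g) h = resultant f h * resultant g h := by
  rw [hf.natDegree_mul hg, resultant_mul_left _ _ _ _ le_rfl]

theorem resultant_add_mul_self_of_monic {R : Type*} [CommRing R] {f : R[X]} (hf : f.Monic)
    (g h : R[X]) : resultant f (g + f * h) = resultant f g := by
  have h1 : (g + f * h).natDegree ≤ max g.natDegree (h.natDegree + f.natDegree) :=
    (natDegree_add_le _ _).trans (max_le_max le_rfl (by rw [add_comm]; exact natDegree_mul_le))
  rw [← resultant_right_deg_eq_of_monic hf _ h1,
    resultant_add_mul_right _ _ _ _ _ (le_max_right _ _) le_rfl,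
    resultant_right_deg_eq_of_monic hf _ (le_max_left _ _)]

theorem Polynomial.Monic.resultant_derivative {R : Type*} [CommRing R] {f : R[X]} (hf : f.Monic) :
    resultant f (derivative f) = (-1) ^ (f.natDegree * (f.natDegree - 1) / 2) * f.discr := by
  rcases Nat.eq_zero_or_pos f.natDegree with h | h
  · rw [hf.natDegree_eq_zero.1 h, ← C_1, discr_C]
    simp
  · rw [← resultant_right_deg_eq_of_monic hf _ (natDegree_derivative_le f),
      resultant_deriv (natDegree_pos_iff_degree_pos.1 h), hf.leadingCoeff, mul_one]

theorem Nat.add_mul_pred_div_two (a b : ℕ) :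
    (a + b) * (a + b - 1) / 2 = a * (a - 1) / 2 + b * (b - 1) / 2 + a * b := by
  simp only [← Nat.choose_two_right]
  rw [Nat.add_choose_eq]
  simp [Finset.Nat.antidiagonal_succ]
  ring

theorem Polynomial.Monic.discr_eq_resultant {R : Type*} [CommRing R] {f : R[X]} (hf : f.Monic) :
    f.discr = (-1) ^ (f.natDegree * (f.natDegree - 1) / 2) * resultant f (derivative f) := by
  rw [hf.resultant_derivative, ← mul_assoc, ← mul_pow]; simp

/-- Modulo `f`, `(fg)' ≡ f'g`, and symmetrically modulo `g`. The sign from swapping `resultant g f`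
cancels the cross term `ab` in `Nat.add_mul_pred_div_two`. -/
theorem Polynomial.Monic.discr_mul {R : Type*} [CommRing R] {f g : R[X]} (hf : f.Monic)
    (hg : g.Monic) : (f * g).discr = f.discr * g.discr * resultant f g ^ 2 := by
  have h1 : resultant f (derivative (f * g)) = resultant f (derivative f) * resultant f g := by
    rw [derivative_mul, resultant_add_mul_self_of_monic hf, resultant_mul_right_of_monic hf]
  have h2 : resultant g (derivative (f * g)) = resultant g f * resultant g (derivative g) := by
    rw [derivative_mul, add_comm, mul_comm _ g, resultant_add_mul_self_of_monic hg,
      resultant_mul_right_of_monic hg]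
  rw [(hf.mul hg).discr_eq_resultant, resultant_mul_left_of_monic hf hg, h1, h2,
    hf.natDegree_mul hg, Nat.add_mul_pred_div_two, pow_add, pow_add, resultant_comm g f,
    mul_comm g.natDegree f.natDegree, hf.discr_eq_resultant, hg.discr_eq_resultant]
  have : ((-1 : R) ^ (f.natDegree * g.natDegree)) ^ 2 = 1 := by rw [← pow_mul, mul_comm]; simp
  generalize f.natDegree * (f.natDegree - 1) / 2 = a
  generalize g.natDegree * (g.natDegree - 1) / 2 = b
  linear_combination (-1 : R) ^ a * (-1 : R) ^ b * resultant f (derivative f) *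
    resultant g (derivative g) * resultant f g ^ 2 * this

theorem discr_ne_zero_iff_squarefree {K : Type*} [Field K] [PerfectField K] {f : K[X]}
    (hf : f.Monic) : f.discr ≠ 0 ↔ Squarefree f := by
  rw [hf.discr_eq_resultant, mul_ne_zero_iff, ← PerfectField.separable_iff_squarefree,
    Polynomial.separable_def, ne_eq, ne_eq, resultant_eq_zero_iff]
  simp [hf.ne_zero]

/-- `scaleRoots` uses the true degree of `f'`; `k` is the amount by which it falls short of `deg f -
1`. -/
theorem derivative_scaleRoots {R : Type*} [CommRing R] [IsDomain R] (f : R[X]) (c : R) :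
    ∃ k, derivative (f.scaleRoots c) = C (c ^ k) * (derivative f).scaleRoots c ∧
      (0 < f.natDegree → (derivative f).natDegree + k = f.natDegree - 1) := by
  refine ⟨f.natDegree - 1 - (derivative f).natDegree, ?_, fun h ↦ ?_⟩
  · ext i
    simp only [coeff_derivative, coeff_scaleRoots, coeff_C_mul]
    by_cases h : f.coeff (i + 1) * ((i : R) + 1) = 0
    · rw [mul_right_comm, h]; ring
    · have h1 : i ≤ (derivative f).natDegree := le_natDegree_of_ne_zero (by rwa [coeff_derivative])
      have h2 := natDegree_derivative_le f
      have h3 : f.natDegree - (i + 1) =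
        f.natDegree - 1 - (derivative f).natDegree + ((derivative f).natDegree - i) := by omega
      rw [h3, pow_add]; ring
  · have := natDegree_derivative_le f
    omega

theorem Polynomial.Monic.discr_scaleRoots {R : Type*} [CommRing R] [IsDomain R] {f : R[X]}
    (hf : f.Monic) (c : R) :
    (f.scaleRoots c).discr = c ^ (f.natDegree * (f.natDegree - 1)) * f.discr := by
  rcases Nat.eq_zero_or_pos f.natDegree with h | h
  · rw [hf.natDegree_eq_zero.1 h]
    simp
  obtain ⟨k, h1, h2⟩ := derivative_scaleRoots f c
  have hm : (f.scaleRoots c).Monic := (monic_scaleRoots_iff c).2 hf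
  rw [hm.discr_eq_resultant, hf.discr_eq_resultant, h1, resultant_mul_right_of_monic hm,
    resultant_scaleRoots, natDegree_scaleRoots, natDegree_C, resultant_C_zero_right, ← h2 h]
  generalize (-1 : R) ^ (f.natDegree * ((derivative f).natDegree + k) / 2) = e
  ring

/-! ### The Pellet–Stickelberger parity theorem. -/

/-- The discriminant of a generator of a finite extension of finite fields satisfies
`disc = δ ^ 2`, where Frobenius multiplies `δ` by the sign of a cycle of full length. -/
theorem FiniteField.exists_sq_eq_discr_powerBasis {F L E : Type*} [Field F] [Fintype F] [Field L]
    [Algebra F L] [Field E] [Algebra F E] [IsAlgClosed E] (pb : PowerBasis F L) :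
    ∃ δ : E, algebraMap F E (Algebra.discr F pb.basis) = δ ^ 2 ∧
      δ ^ Fintype.card F = (-1) ^ (pb.dim - 1) * δ := by
  have := pb.finite
  have : Finite L := Module.finite_of_finite F
  have := Fintype.ofFinite L
  let φ := FiniteField.frobeniusAlgHom F L
  let ι : L →ₐ[F] E := IsAlgClosed.lift
  have hι : Function.Bijective fun i : Fin pb.dim ↦ ι.comp (φ ^ (i : ℕ)) := by
    rw [Fintype.bijective_iff_injective_and_card, AlgHom.card, Fintype.card_fin, pb.finrank]
    refine ⟨fun i j h ↦ ?_, rfl⟩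
    refine (finCongr pb.finrank.symm).injective
      ((FiniteField.bijective_frobeniusAlgHom_pow F L).1 (AlgHom.ext fun x ↦ ?_))
    exact ι.injective (DFunLike.congr_fun h x)
  let e : Fin pb.dim ≃ (L →ₐ[F] E) := Equiv.ofBijective _ hι
  have he (i : Fin pb.dim) : e i = ι.comp (φ ^ (i : ℕ)) := rfl
  have hφ : φ ^ pb.dim = 1 := by
    rw [← pb.finrank, ← FiniteField.orderOf_frobeniusAlgHom F L, pow_orderOf_eq_one]
  let ψ := FiniteField.frobeniusAlgHom F E
  have hψ (x : L) : ψ (ι x) = ι (φ x) := by simp [ψ, φ]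
  refine ⟨(Algebra.embeddingsMatrixReindex F E pb.basis e).det,
    Algebra.discr_eq_det_embeddingsMatrixReindex_pow_two F E pb.basis e, ?_⟩
  -- The columns are the embeddings `ι ∘ φ^i`; Frobenius sends column `i` to column `i + 1`,
  -- wrapping around because `φ ^ dim = 1`.
  have hrot : (Algebra.embeddingsMatrixReindex F E pb.basis e).map ψ =
      (Algebra.embeddingsMatrixReindex F E pb.basis e).submatrix id (finRotate pb.dim) := by
    ext i j
    simp only [Algebra.embeddingsMatrixReindex, Algebra.embeddingsMatrix, Matrix.map_apply,
      Matrix.submatrix_apply, Matrix.reindex_apply, Matrix.of_apply, Equiv.symm_symm, he,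
      Equiv.refl_symm, Equiv.coe_refl, id, AlgHom.comp_apply, hψ]
    rw [← AlgHom.mul_apply, ← pow_succ']
    have : φ ^ ((finRotate pb.dim j : Fin _) : ℕ) = φ ^ ((j : ℕ) + 1) := by
      obtain ⟨n, hn⟩ := Nat.exists_eq_succ_of_ne_zero pb.dim_pos.ne'
      clear_value φ
      revert j hφ
      generalize pb.dim = d at hn
      subst hn
      intro hφ j
      rw [coe_finRotate]
      split_ifs with h
      · rw [h, Fin.val_last, hφ, pow_zero]
      · rfl
    rw [this]
  have h1 := congrArg Matrix.det hrot
  rw [Matrix.det_permute', sign_finRotate] at h1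
  have h2 := (RingHom.map_det ψ.toRingHom (Algebra.embeddingsMatrixReindex F E pb.basis e)).trans h1
  simpa [ψ] using h2

/-- Up to the same sign, both sides are the product of `f'` over the roots of the minimal polynomial
`f`: a resultant on the left, the norm of `f'(gen)` on the right, with embeddings corresponding to
roots. -/
theorem Polynomial.discr_minpoly_gen {F L : Type*} [Field F] [Field L]
    [Algebra F L] [Algebra.IsSeparable F L] (pb : PowerBasis F L) :
    (minpoly F pb.gen).discr = Algebra.discr F pb.basis := by
  have := pb.finite
  let E := AlgebraicClosure F
  have hm : (minpoly F pb.gen).Monic := minpoly.monic pb.isIntegral_gen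
  rw [hm.discr_eq_resultant, Algebra.discr_powerBasis_eq_norm, pb.finrank, pb.natDegree_minpoly]
  congr 1
  apply (algebraMap F E).injective
  have hsplit : ((minpoly F pb.gen).map (algebraMap F E)).Splits := IsAlgClosed.splits _
  have hnd : ((minpoly F pb.gen).aroots E).Nodup :=
    nodup_roots (Separable.map (Algebra.IsSeparable.isSeparable F pb.gen))
  rw [Algebra.norm_eq_prod_embeddings, ← resultant_map_map,
    ← pb.natDegree_minpoly, ← natDegree_map (algebraMap F E) (p := minpoly F pb.gen),
    resultant_eq_prod_eval _ _ _ natDegree_map_le hsplit, (hm.map _).leadingCoeff, one_pow, one_mul]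
  classical
  change (((minpoly F pb.gen).aroots E).map _).prod = _
  rw [Finset.prod_multiset_map_count]
  rw [Finset.prod_congr rfl fun x hx ↦ by
    rw [Multiset.count_eq_one_of_mem hnd (Multiset.mem_toFinset.1 hx), pow_one]]
  symm
  refine Finset.prod_bij (fun σ _ ↦ σ pb.gen) ?_ ?_ ?_ ?_
  · intro σ _
    exact Multiset.mem_toFinset.2 (pb.liftEquiv' σ).2
  · intro σ _ τ _ h
    exact pb.algHom_ext h
  · intro y hy
    exact ⟨pb.liftEquiv'.symm ⟨y, Multiset.mem_toFinset.1 hy⟩, Finset.mem_univ _,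
      congrArg Subtype.val (pb.liftEquiv'.apply_symm_apply ⟨y, Multiset.mem_toFinset.1 hy⟩)⟩
  · intro σ _
    rw [← aeval_algHom_apply, eval_map_algebraMap]

/-- Stickelberger's parity theorem for irreducible polynomials. -/
theorem quadraticChar_discr_of_irreducible {F : Type*} [Field F] [Fintype F] [DecidableEq F]
    (hF : ringChar F ≠ 2) {f : F[X]} (hf : f.Monic) (hirr : Irreducible f) :
    quadraticChar F f.discr = (-1) ^ (f.natDegree - 1) := by
  have := Fact.mk hirr
  let pb := AdjoinRoot.powerBasis hirr.ne_zero
  have := pb.finite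
  let E := AlgebraicClosure F
  have hmin : minpoly F pb.gen = f := by
    rw [AdjoinRoot.powerBasis_gen, AdjoinRoot.minpoly_root hirr.ne_zero, hf.leadingCoeff]
    simp
  obtain ⟨δ, hδ, hδ'⟩ := FiniteField.exists_sq_eq_discr_powerBasis (E := E) pb
  rw [← discr_minpoly_gen, hmin] at hδ
  have hne : f.discr ≠ 0 := (discr_ne_zero_iff_squarefree hf).2 hirr.squarefree
  have hδ0 : δ ≠ 0 := by
    rintro rfl
    rw [zero_pow two_ne_zero] at hδ
    exact hne ((map_eq_zero _).1 hδ)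
  have hdim : pb.dim = f.natDegree := by rw [← pb.natDegree_minpoly, hmin]
  have hodd := FiniteField.odd_card_of_char_ne_two hF
  -- Euler's criterion: `disc^((q-1)/2) = δ^(q-1)`, the sign by which Frobenius acts on `δ`.
  have h1 : (algebraMap F E) (f.discr ^ (Fintype.card F / 2)) = (-1) ^ (f.natDegree - 1) := by
    apply mul_right_cancel₀ hδ0
    rw [map_pow, hδ, ← pow_mul, ← pow_succ, ← hdim, ← hδ']
    congr 1
    omega
  rw [← quadraticChar_eq_pow_of_char_ne_two' hF] at h1
  have h2 : ((quadraticChar F f.discr : ℤ) : F) = (((-1) ^ (f.natDegree - 1) : ℤ) : F) := by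
    apply (algebraMap F E).injective
    rw [h1]; simp
  refine Int.cast_injOn_of_ringChar_ne_two hF ?_ ?_ h2
  · rcases quadraticChar_dichotomy hne with h | h <;> simp [h]
  · rcases neg_one_pow_eq_or ℤ (f.natDegree - 1) with h | h <;> simp [h]

/-- The Pellet–Stickelberger parity theorem: the quadratic character of the discriminant of a
squarefree polynomial detects the parity of its degree minus its number of irreducible factors. -/
theorem quadraticChar_discr_prod {F : Type*} [Field F] [Fintype F] [DecidableEq F]
    (hF : ringChar F ≠ 2) (s : Finset F[X]) (hs : ∀ p ∈ s, p.Monic ∧ Irreducible p) :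
    quadraticChar F (∏ p ∈ s, p).discr = (-1) ^ ((∏ p ∈ s, p).natDegree + s.card) := by
  classical
  induction s using Finset.induction_on with
  | empty => simp [← C_1, -map_one]
  | insert p s hps ih =>
    have hp := hs p (Finset.mem_insert_self _ _)
    have hs' : ∀ r ∈ s, r.Monic ∧ Irreducible r := fun r hr ↦ hs r (Finset.mem_insert_of_mem hr)
    have hm : (∏ p ∈ s, p).Monic := monic_prod_of_monic _ _ fun r hr ↦ (hs' r hr).1
    have hcop : IsCoprime p (∏ p ∈ s, p) := by
      refine IsCoprime.prod_right fun r hr ↦ hp.2.coprime_iff_not_dvd.2 fun hdvd ↦ hps ?_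
      rwa [eq_of_monic_of_associated hp.1 (hs' r hr).1
        (hp.2.associated_of_dvd (hs' r hr).2 hdvd)]
    have hdeg := hp.2.natDegree_pos
    rw [Finset.prod_insert hps, hp.1.discr_mul hm, map_mul, map_mul,
      quadraticChar_sq_one' (resultant_ne_zero _ _ hcop), mul_one, ih hs',
      quadraticChar_discr_of_irreducible hF hp.1 hp.2, hp.1.natDegree_mul hm,
      Finset.card_insert_of_notMem hps, ← pow_add, neg_one_pow_congr]
    simp only [Nat.even_iff]
    omega

/-! ### Möbius sums and squarefree counts over a finite field. -/

/-- The monic polynomials of degree `n` over a finite field, as a finite set. -/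
noncomputable def monicFinset (F : Type*) [Field F] [Finite F] (n : ℕ) : Finset F[X] :=
  Set.Finite.toFinset (s := {f : F[X] | f.Monic ∧ f.natDegree = n}) <|
    Set.finite_coe_iff.1 (Finite.of_equiv _ ((monicEquivDegreeLT n).trans (degreeLTEquiv F n).toEquiv).symm :
      Finite {f : F[X] // f.Monic ∧ f.natDegree = n})

section

variable {F : Type*} [Field F] [Fintype F]

theorem mem_monicFinset {n : ℕ} {f : F[X]} : f ∈ monicFinset F n ↔ f.Monic ∧ f.natDegree = n := by
  rw [monicFinset, Set.Finite.mem_toFinset, Set.mem_ofPred_eq]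

theorem card_monicFinset (n : ℕ) : (monicFinset F n).card = Fintype.card F ^ n := by
  have := Nat.card_congr ((monicEquivDegreeLT n).trans (degreeLTEquiv F n).toEquiv)
  rw [Nat.card_fun, Nat.card_eq_fintype_card (α := Fin n), Fintype.card_fin,
    Nat.card_eq_fintype_card (α := F)] at this
  rw [← this, Nat.card_congr (Equiv.subtypeEquivRight fun f ↦ mem_monicFinset.symm),
    Nat.card_eq_fintype_card, Fintype.card_coe]

theorem card_monicFinset_filter_dvd {n : ℕ} {d : F[X]} (hd : d.Monic) [DecidablePred (d ∣ ·)] :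
    ((monicFinset F n).filter (d ∣ ·)).card =
      if d.natDegree ≤ n then Fintype.card F ^ (n - d.natDegree) else 0 := by
  split_ifs with h
  · rw [← card_monicFinset]
    symm
    refine Finset.card_bij (fun g _ ↦ d * g) ?_ ?_ ?_
    · intro g hg
      rw [mem_monicFinset] at hg
      rw [Finset.mem_filter, mem_monicFinset]
      exact ⟨⟨hd.mul hg.1, by rw [hd.natDegree_mul hg.1]; omega⟩, dvd_mul_right _ _⟩
    · intro g _ g' _ h
      exact mul_left_cancel₀ hd.ne_zero h
    · intro f hf
      rw [Finset.mem_filter, mem_monicFinset] at hf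
      obtain ⟨⟨hf, hn⟩, g, rfl⟩ := hf
      have hg := hd.of_mul_monic_left hf
      rw [hd.natDegree_mul hg] at hn
      exact ⟨g, mem_monicFinset.2 ⟨hg, by omega⟩, rfl⟩
  · rw [Finset.card_eq_zero, Finset.filter_eq_empty_iff]
    rintro f hf hdf
    rw [mem_monicFinset] at hf
    exact h (hf.2 ▸ natDegree_le_of_dvd hdf hf.1.ne_zero)

/-- The monic irreducible polynomials of degree at most `n` over a finite field. -/
noncomputable def monicIrreducibleFinset (F : Type*) [Field F] [Finite F] (n : ℕ) : Finset F[X] := by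
  classical
  exact ((Finset.range (n + 1)).biUnion (monicFinset F)).filter Irreducible

theorem mem_monicIrreducibleFinset {n : ℕ} {p : F[X]} :
    p ∈ monicIrreducibleFinset F n ↔ p.Monic ∧ Irreducible p ∧ p.natDegree ≤ n := by
  simp [monicIrreducibleFinset, mem_monicFinset]
  tauto

omit [Fintype F] in
theorem prod_pow_dvd_iff {s : Finset F[X]} (hs : ∀ p ∈ s, p.Monic ∧ Irreducible p) (k : ℕ)
    (f : F[X]) : (∏ p ∈ s, p) ^ k ∣ f ↔ ∀ p ∈ s, p ^ k ∣ f := by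
  refine ⟨fun h p hp ↦ (pow_dvd_pow_of_dvd (Finset.dvd_prod_of_mem (fun p ↦ p) hp) k).trans h, fun h ↦ ?_⟩
  rw [← Finset.prod_pow]
  refine Finset.prod_dvd_of_coprime (fun p hp p' hp' hne ↦ ?_) h
  refine IsCoprime.pow ((hs p hp).2.coprime_iff_not_dvd.2 fun hdvd ↦ hne ?_)
  exact eq_of_monic_of_associated (hs p hp).1 (hs p' hp').1
    ((hs p hp).2.associated_of_dvd (hs p' hp').2 hdvd)

omit [Fintype F] in
theorem monic_prod_of_monicIrreducible {s : Finset F[X]} (hs : ∀ p ∈ s, p.Monic ∧ Irreducible p) :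
    (∏ p ∈ s, p).Monic := monic_prod_of_monic _ _ fun p hp ↦ (hs p hp).1

open Classical in
-- Inclusion–exclusion: `s` encodes the squarefree `d = ∏ p`, with `μ(d) = (-1)^|s|`, and the power
-- of `q` counts the monic multiples of `d^k` in degree `n`. `N` only keeps the set of irreducibles
-- finite.
theorem sum_sign_mul_card_multiples (N k n : ℕ) (hk : k ≠ 0) (hn : n ≤ N) :
    ∑ s ∈ (monicIrreducibleFinset F N).powerset with k * (∏ p ∈ s, p).natDegree ≤ n,
      (-1 : ℤ) ^ s.card * (Fintype.card F : ℤ) ^ (n - k * (∏ p ∈ s, p).natDegree) =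
    ({f ∈ monicFinset F n | ∀ p, p.Monic → Irreducible p → ¬ p ^ k ∣ f} : Finset F[X]).card := by
  have hU {s} (h : s ∈ (monicIrreducibleFinset F N).powerset) : ∀ p ∈ s, p.Monic ∧ Irreducible p :=
    fun p hp ↦ ⟨(mem_monicIrreducibleFinset.1 (Finset.mem_powerset.1 h hp)).1,
      (mem_monicIrreducibleFinset.1 (Finset.mem_powerset.1 h hp)).2.1⟩
  have h1 : ∀ f ∈ monicFinset F n,
      ∑ s ∈ (monicIrreducibleFinset F N).powerset with (∏ p ∈ s, p) ^ k ∣ f, (-1 : ℤ) ^ s.card =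
      if ∀ p, p.Monic → Irreducible p → ¬ p ^ k ∣ f then 1 else 0 := by
    intro f hf
    have h2 : {s ∈ (monicIrreducibleFinset F N).powerset | (∏ p ∈ s, p) ^ k ∣ f} =
        {p ∈ monicIrreducibleFinset F N | p ^ k ∣ f}.powerset := by
      ext s
      rw [Finset.mem_filter]
      constructor
      · rintro ⟨h, h'⟩
        rw [prod_pow_dvd_iff (hU h)] at h'
        exact Finset.mem_powerset.2 fun p hp ↦
          Finset.mem_filter.2 ⟨Finset.mem_powerset.1 h hp, h' p hp⟩
      · intro h
        have hs : s ∈ (monicIrreducibleFinset F N).powerset := Finset.mem_powerset.2 <|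
          (Finset.mem_powerset.1 h).trans (Finset.filter_subset _ _)
        exact ⟨hs, (prod_pow_dvd_iff (hU hs) k f).2 fun p hp ↦
          (Finset.mem_filter.1 (Finset.mem_powerset.1 h hp)).2⟩
    rw [h2, Finset.sum_powerset_neg_one_pow_card]
    refine if_congr ?_ rfl rfl
    rw [Finset.filter_eq_empty_iff]
    refine ⟨fun h p hp hp' hd ↦ h ?_ hd, fun h p hp ↦ ?_⟩
    · rw [mem_monicFinset] at hf
      exact mem_monicIrreducibleFinset.2 ⟨hp, hp', (natDegree_le_of_dvd
        ((dvd_pow_self p hk).trans hd) hf.1.ne_zero).trans (hf.2.le.trans hn)⟩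
    · rw [mem_monicIrreducibleFinset] at hp
      exact h p hp.1 hp.2.1
  rw [Finset.card_filter, Nat.cast_sum]
  push_cast
  rw [← Finset.sum_congr rfl h1]
  simp_rw [Finset.sum_filter]
  rw [Finset.sum_comm]
  refine Finset.sum_congr rfl fun s hs ↦ ?_
  have h3 := card_monicFinset_filter_dvd (n := n) ((monic_prod_of_monicIrreducible (hU hs)).pow k)
  rw [natDegree_pow] at h3
  rw [← Finset.sum_filter, Finset.sum_const, h3]
  split_ifs <;> simp [mul_comm]

open Classical in
/-- The summatory Möbius function over monic polynomials of degree `j ≥ 2` vanishes; squarefree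
polynomials are represented by their sets of monic irreducible factors. -/
theorem sum_sign_natDegree_eq (N j : ℕ) (hj : j ≤ N) :
    ∑ s ∈ (monicIrreducibleFinset F N).powerset with (∏ p ∈ s, p).natDegree = j,
      (-1 : ℤ) ^ s.card = if j = 0 then 1 else if j = 1 then - (Fintype.card F : ℤ) else 0 := by
  -- Sieve with `k = 1`: only the polynomial `1` has no irreducible factor. Subtracting `q` times
  -- the identity at `n` from the one at `n + 1` then isolates degree `n + 1`.
  have hH (n : ℕ) (hn : n ≤ N) :
      ∑ s ∈ (monicIrreducibleFinset F N).powerset with (∏ p ∈ s, p).natDegree ≤ n,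
        (-1 : ℤ) ^ s.card * (Fintype.card F : ℤ) ^ (n - (∏ p ∈ s, p).natDegree) =
      if n = 0 then 1 else 0 := by
    have h1 := sum_sign_mul_card_multiples (F := F) N 1 n one_ne_zero hn
    simp only [one_mul, pow_one] at h1
    rw [h1]
    split_ifs with h
    · rw [Finset.filter_true_of_mem, card_monicFinset, h, pow_zero, Nat.cast_one]
      intro f hf p _ hp hd
      rw [mem_monicFinset] at hf
      rw [hf.1.natDegree_eq_zero.1 (hf.2.trans h)] at hd
      exact hp.not_isUnit (isUnit_of_dvd_one hd)
    · rw [Finset.filter_false_of_mem, Finset.card_empty, Nat.cast_zero]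
      intro f hf hall
      rw [mem_monicFinset] at hf
      obtain ⟨p, hpm, hp, hd⟩ := exists_monic_irreducible_factor f fun hu ↦
        h (hf.2.symm.trans (natDegree_eq_zero_of_isUnit hu))
      exact hall p hpm hp hd
  rcases j with _ | n
  · simpa using hH 0 hj
  · have h0 := hH n (by omega)
    have h1 := hH (n + 1) hj
    have h2 : ∀ s : Finset F[X], (∏ p ∈ s, p).natDegree ≤ n + 1 ↔
        (∏ p ∈ s, p).natDegree = n + 1 ∨ (∏ p ∈ s, p).natDegree ≤ n := fun s ↦ by omega
    simp_rw [h2] at h1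
    rw [Finset.filter_or, Finset.sum_union] at h1
    · have h3 : ∀ s ∈ (monicIrreducibleFinset F N).powerset.filter
          (fun s ↦ (∏ p ∈ s, p).natDegree ≤ n),
          (-1 : ℤ) ^ s.card * (Fintype.card F : ℤ) ^ (n + 1 - (∏ p ∈ s, p).natDegree) =
          Fintype.card F * ((-1 : ℤ) ^ s.card *
            (Fintype.card F : ℤ) ^ (n - (∏ p ∈ s, p).natDegree)) := fun s hs ↦ by
        rw [Nat.succ_sub (Finset.mem_filter.1 hs).2, pow_succ]; ring
      have h4 : ∀ s ∈ (monicIrreducibleFinset F N).powerset.filter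
          (fun s ↦ (∏ p ∈ s, p).natDegree = n + 1),
          (-1 : ℤ) ^ s.card * (Fintype.card F : ℤ) ^ (n + 1 - (∏ p ∈ s, p).natDegree) =
          (-1 : ℤ) ^ s.card := fun s hs ↦ by simp [(Finset.mem_filter.1 hs).2]
      rw [Finset.sum_congr rfl h3, Finset.sum_congr rfl h4, ← Finset.mul_sum, h0] at h1
      rcases n with _ | n
      · simp at h1 ⊢
        linarith
      · simpa using h1
    · rw [Finset.disjoint_filter]
      intro s _ h h'
      omega

open Classical in
-- Sieve with `k = 2`: the Möbius sums vanish beyond degree `1`, leaving `q^n - q · q^(n-2)`.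
theorem card_squarefree_monicFinset (n : ℕ) (hn : 2 ≤ n) :
    ({f ∈ monicFinset F n | Squarefree f} : Finset F[X]).card + Fintype.card F ^ (n - 1) =
      Fintype.card F ^ n := by
  have h1 := sum_sign_mul_card_multiples (F := F) n 2 n two_ne_zero le_rfl
  have h2 : ({f ∈ monicFinset F n | ∀ p, p.Monic → Irreducible p → ¬ p ^ 2 ∣ f} : Finset F[X]) =
      {f ∈ monicFinset F n | Squarefree f} := by
    refine Finset.filter_congr fun f hf ↦ ?_
    rw [mem_monicFinset] at hf
    rw [squarefree_iff_irreducible_sq_not_dvd_of_ne_zero hf.1.ne_zero]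
    refine ⟨fun h p hp hd ↦ ?_, fun h p _ hp hd ↦ h p hp (by rwa [← sq])⟩
    refine h (normalize p) (monic_normalize hp.ne_zero)
      ((associated_normalize p).irreducible hp) ?_
    rw [sq]
    exact (((normalize_associated p).mul_mul (normalize_associated p)).dvd).trans hd
  have h3 : ∑ s ∈ (monicIrreducibleFinset F n).powerset with 2 * (∏ p ∈ s, p).natDegree ≤ n,
      (-1 : ℤ) ^ s.card * (Fintype.card F : ℤ) ^ (n - 2 * (∏ p ∈ s, p).natDegree) =
      (Fintype.card F : ℤ) ^ n - Fintype.card F * (Fintype.card F : ℤ) ^ (n - 2) := by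
    rw [← Finset.sum_fiberwise_of_maps_to (t := Finset.range (n / 2 + 1))
      (g := fun s ↦ (∏ p ∈ s, p).natDegree)]
    · have h4 : ∀ j ∈ Finset.range (n / 2 + 1),
          ∑ s ∈ {s ∈ (monicIrreducibleFinset F n).powerset | 2 * (∏ p ∈ s, p).natDegree ≤ n} with
            (∏ p ∈ s, p).natDegree = j,
            (-1 : ℤ) ^ s.card * (Fintype.card F : ℤ) ^ (n - 2 * (∏ p ∈ s, p).natDegree) =
          (if j = 0 then 1 else if j = 1 then - (Fintype.card F : ℤ) else 0) *
            (Fintype.card F : ℤ) ^ (n - 2 * j) := by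
        intro j hj
        rw [Finset.mem_range] at hj
        rw [← sum_sign_natDegree_eq n j (by omega), Finset.sum_mul, Finset.filter_filter]
        refine Finset.sum_congr (Finset.filter_congr fun s _ ↦ by omega) fun s hs ↦ ?_
        rw [(Finset.mem_filter.1 hs).2]
      rw [Finset.sum_congr rfl h4, ← Finset.sum_subset (s₁ := Finset.range 2)]
      · simp [Finset.sum_range_succ]
        ring
      · intro j; simp only [Finset.mem_range]; omega
      · intro j _ hj
        rw [Finset.mem_range] at hj
        rw [if_neg (by omega), if_neg (by omega), zero_mul]
    · intro s hs
      have := (Finset.mem_filter.1 hs).2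
      exact Finset.mem_range.2 (by omega)
  rw [h2, h3] at h1
  obtain ⟨k, rfl⟩ := Nat.exists_eq_add_of_le' hn
  zify
  rw [← h1]
  simp [pow_succ]
  ring

omit [Fintype F] in
theorem squarefree_prod_of_monicIrreducible {s : Finset F[X]}
    (hs : ∀ p ∈ s, p.Monic ∧ Irreducible p) : Squarefree (∏ p ∈ s, p) := by
  refine Finset.squarefree_prod_of_pairwise_isCoprime (fun p hp r hr hne ↦ ?_) fun p hp ↦
    (hs p hp).2.squarefree
  refine ((hs p hp).2.coprime_iff_not_dvd.2 fun hd ↦ hne ?_).isRelPrime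
  exact eq_of_monic_of_associated (hs p hp).1 (hs r hr).1
    ((hs p hp).2.associated_of_dvd (hs r hr).2 hd)

omit [Fintype F] in
theorem Polynomial.Monic.exists_eq_prod_of_squarefree {f : F[X]} (hf : f.Monic)
    (hsq : Squarefree f) :
    ∃ s : Finset F[X], (∀ p ∈ s, p.Monic ∧ Irreducible p) ∧ f = ∏ p ∈ s, p := by
  classical
  have hnd := (UniqueFactorizationMonoid.squarefree_iff_nodup_normalizedFactors hf.ne_zero).1 hsq
  refine ⟨⟨_, hnd⟩, fun p hp ↦ ?_, ?_⟩
  · have hp : p ∈ UniqueFactorizationMonoid.normalizedFactors f := hp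
    have hirr := UniqueFactorizationMonoid.irreducible_of_normalized_factor _ hp
    exact ⟨UniqueFactorizationMonoid.normalize_normalized_factor p hp ▸
      monic_normalize hirr.ne_zero, hirr⟩
  · rw [Finset.prod_mk, Multiset.map_id']
    have h := UniqueFactorizationMonoid.prod_normalizedFactors_eq hf.ne_zero
    rw [h, hf.normalize_eq_self]

open Classical in
theorem sum_squarefree_eq_sum_powerset {M : Type*} [AddCommMonoid M] (n : ℕ) (φ : F[X] → M) :
    ∑ f ∈ monicFinset F n with Squarefree f, φ f =
      ∑ s ∈ (monicIrreducibleFinset F n).powerset with (∏ p ∈ s, p).natDegree = n,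
        φ (∏ p ∈ s, p) := by
  have hU {s} (h : s ∈ (monicIrreducibleFinset F n).powerset) : ∀ p ∈ s, p.Monic ∧ Irreducible p :=
    fun p hp ↦ ⟨(mem_monicIrreducibleFinset.1 (Finset.mem_powerset.1 h hp)).1,
      (mem_monicIrreducibleFinset.1 (Finset.mem_powerset.1 h hp)).2.1⟩
  symm
  refine Finset.sum_bij (fun s _ ↦ ∏ p ∈ s, p) ?_ ?_ ?_ fun _ _ ↦ rfl
  · intro s hs
    rw [Finset.mem_filter] at hs
    exact Finset.mem_filter.2 ⟨mem_monicFinset.2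
      ⟨monic_prod_of_monicIrreducible (hU hs.1), hs.2⟩,
      squarefree_prod_of_monicIrreducible (hU hs.1)⟩
  · have key {s t : Finset F[X]} (hs : ∀ p ∈ s, p.Monic ∧ Irreducible p)
        (ht : ∀ p ∈ t, p.Monic ∧ Irreducible p) (h : ∏ p ∈ s, p = ∏ p ∈ t, p) : s ⊆ t := by
      intro p hp
      have hd : p ∣ ∏ p ∈ t, p := h ▸ Finset.dvd_prod_of_mem (fun p ↦ p) hp
      obtain ⟨r, hr, hpr⟩ := (hs p hp).2.prime.exists_mem_finset_dvd hd
      rwa [eq_of_monic_of_associated (hs p hp).1 (ht r hr).1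
        ((hs p hp).2.associated_of_dvd (ht r hr).2 hpr)]
    intro s hs t ht h
    rw [Finset.mem_filter] at hs ht
    exact (key (hU hs.1) (hU ht.1) h).antisymm (key (hU ht.1) (hU hs.1) h.symm)
  · intro f hf
    rw [Finset.mem_filter, mem_monicFinset] at hf
    obtain ⟨⟨hm, hn⟩, hsq⟩ := hf
    obtain ⟨s, hs, rfl⟩ := hm.exists_eq_prod_of_squarefree hsq
    refine ⟨s, Finset.mem_filter.2 ⟨Finset.mem_powerset.2 fun p hp ↦ ?_, hn⟩, rfl⟩
    exact mem_monicIrreducibleFinset.2 ⟨(hs p hp).1, (hs p hp).2, hn ▸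
      natDegree_le_of_dvd (Finset.dvd_prod_of_mem (fun p ↦ p) hp) hm.ne_zero⟩

/-- Non-squarefree terms are `0`; by the parity theorem the rest is `(-1)^n` times the Möbius sum in
degree `n`. -/
theorem sum_quadraticChar_discr [DecidableEq F] (hF : ringChar F ≠ 2) (n : ℕ) (hn : 2 ≤ n) :
    ∑ f ∈ monicFinset F n, quadraticChar F f.discr = 0 := by
  classical
  rw [← Finset.sum_filter_of_ne (p := Squarefree), sum_squarefree_eq_sum_powerset]
  · have h1 : ∀ s ∈ (monicIrreducibleFinset F n).powerset.filter
        (fun s ↦ (∏ p ∈ s, p).natDegree = n),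
        quadraticChar F (∏ p ∈ s, p).discr = (-1) ^ n * (-1) ^ s.card := fun s hs ↦ by
      rw [Finset.mem_filter, Finset.mem_powerset] at hs
      rw [quadraticChar_discr_prod hF, hs.2, pow_add]
      intro p hp
      have := mem_monicIrreducibleFinset.1 (hs.1 hp)
      exact ⟨this.1, this.2.1⟩
    rw [Finset.sum_congr rfl h1, ← Finset.mul_sum, sum_sign_natDegree_eq n n le_rfl,
      if_neg (by omega), if_neg (by omega), mul_zero]
  · intro f hf hne
    rw [mem_monicFinset] at hf
    rwa [← discr_ne_zero_iff_squarefree hf.1, ne_eq, ← quadraticChar_eq_zero_iff]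

end

/-! ### Root scaling and factorization types. -/

/-- Scaling the roots by a unit, as a multiplicative automorphism of `K[X]`. -/
noncomputable def scaleRootsMulEquiv {K : Type*} [Field K] (c : Kˣ) : K[X] ≃* K[X] where
  toFun f := f.scaleRoots c
  invFun f := f.scaleRoots ↑c⁻¹
  left_inv f := by dsimp only; rw [← scaleRoots_mul, Units.mul_inv, scaleRoots_one]
  right_inv f := by dsimp only; rw [← scaleRoots_mul, Units.inv_mul, scaleRoots_one]
  map_mul' f g := mul_scaleRoots_of_noZeroDivisors f g _

theorem Irreducible.scaleRoots {K : Type*} [Field K] {f : K[X]} (hf : Irreducible f) (c : Kˣ) :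
    Irreducible (f.scaleRoots (c : K)) :=
  (MulEquiv.irreducible_iff (scaleRootsMulEquiv c)).2 hf

theorem HasFactorizationType.scaleRoots {K : Type*} [Field K] {m : ℕ} {lam : m.Partition}
    {f : K[X]} (hf : HasFactorizationType f lam) (c : Kˣ) :
    HasFactorizationType (f.scaleRoots (c : K)) lam := by
  obtain ⟨s, hs, rfl, hlam⟩ := hf
  refine ⟨s.map (scaleRootsMulEquiv c).toEquiv.toEmbedding, ?_, ?_, ?_⟩
  · intro p hp
    obtain ⟨r, hr, rfl⟩ := Finset.mem_map.1 hp
    exact ⟨(monic_scaleRoots_iff _).2 (hs r hr).1, (hs r hr).2.scaleRoots c⟩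
  · rw [Finset.prod_map]
    exact map_prod (scaleRootsMulEquiv c) _ _
  · rw [← hlam, Finset.map_val, Multiset.map_map]
    exact Multiset.map_congr rfl fun p _ ↦ natDegree_scaleRoots p _

theorem HasFactorizationType.natDegree_eq {K : Type*} [Field K] {m : ℕ} {lam : m.Partition}
    {f : K[X]} (hf : HasFactorizationType f lam) : f.natDegree = m := by
  obtain ⟨s, hs, rfl, hlam⟩ := hf
  rw [natDegree_prod_of_monic _ _ fun p hp ↦ (hs p hp).1, ← lam.parts_sum, ← hlam]
  rfl

theorem HasFactorizationType.monic {K : Type*} [Field K] {m : ℕ} {lam : m.Partition}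
    {f : K[X]} (hf : HasFactorizationType f lam) : f.Monic := by
  obtain ⟨s, hs, rfl, hlam⟩ := hf
  exact monic_prod_of_monicIrreducible hs

theorem HasFactorizationType.squarefree {K : Type*} [Field K] {m : ℕ} {lam : m.Partition}
    {f : K[X]} (hf : HasFactorizationType f lam) : Squarefree f := by
  obtain ⟨s, hs, rfl, hlam⟩ := hf
  exact squarefree_prod_of_monicIrreducible hs

theorem Nat.Partition.card_parts_le {m : ℕ} (lam : m.Partition) : lam.parts.card ≤ m := by
  have h := Multiset.card_nsmul_le_sum (s := lam.parts) (a := 1) fun x hx ↦ lam.parts_pos hx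
  rwa [smul_eq_mul, mul_one, lam.parts_sum] at h

/-- In a finite group whose order divides `n`, squares are `k`-th powers if `gcd(n, k) = 2`. -/
theorem exists_pow_eq_sq {G : Type*} [Group G] {n k : ℕ} (h : Nat.gcd n k = 2)
    (hG : ∀ g : G, g ^ n = 1) (u : G) : ∃ c : G, c ^ k = u ^ 2 := by
  -- Bézout: `2 = n·a + k·b`, and `u ^ (n·a) = 1`.
  refine ⟨u ^ Nat.gcdB n k, ?_⟩
  have h1 := Nat.gcd_eq_gcd_ab n k
  rw [h] at h1
  rw [← zpow_natCast u 2, h1, zpow_add, zpow_mul, zpow_natCast, hG, one_zpow, one_mul,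
    ← zpow_natCast, ← zpow_mul, mul_comm]

/-! ### Equidistribution within quadratic classes. -/

section

variable {F : Type*} [Field F] [Fintype F] [DecidableEq F]

theorem exists_pow_mul_eq_of_quadraticChar_eq {k : ℕ}
    (hgcd : Nat.gcd (Fintype.card F - 1) k = 2) {d d' : F} (hd : d ≠ 0) (hd' : d' ≠ 0)
    (h : quadraticChar F d = quadraticChar F d') : ∃ c : Fˣ, d' = (c : F) ^ k * d := by
  have hsq : IsSquare (d' / d) := by
    rw [← quadraticChar_one_iff_isSquare (div_ne_zero hd' hd), div_eq_mul_inv, map_mul, ← h,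
      ← map_mul, mul_inv_cancel₀ hd, map_one]
  obtain ⟨u, hu⟩ := hsq
  have hu0 : u ≠ 0 := by
    rintro rfl
    exact div_ne_zero hd' hd (by simpa using hu)
  obtain ⟨c, hc⟩ := exists_pow_eq_sq (G := Fˣ) hgcd
    (fun g ↦ by rw [← Fintype.card_units, pow_card_eq_one]) (Units.mk0 u hu0)
  refine ⟨c, ?_⟩
  have hc' := congrArg (Units.val) hc
  rw [Units.val_pow_eq_pow_val, Units.val_pow_eq_pow_val, Units.val_mk0, sq, ← hu] at hc'
  rw [hc', div_mul_cancel₀ _ hd]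

/-- Since `d'/d` is a square, it equals some `c ^ (m(m-1))`; scaling by `c` injects one fibre into
the other, and the roles are symmetric. -/
theorem encard_discr_fiber_eq {m : ℕ} (hgcd : Nat.gcd (Fintype.card F - 1) (m * (m - 1)) = 2)
    {S : Set F[X]} (hS : S ⊆ monicsOfDegree F m)
    (hscale : ∀ f ∈ S, ∀ c : Fˣ, f.scaleRoots (c : F) ∈ S) {d d' : F} (hd : d ≠ 0) (hd' : d' ≠ 0)
    (h : quadraticChar F d = quadraticChar F d') :
    {f ∈ S | f.discr = d}.encard = {f ∈ S | f.discr = d'}.encard := by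
  have key {d d' : F} (hd : d ≠ 0) (hd' : d' ≠ 0) (h : quadraticChar F d = quadraticChar F d') :
      {f ∈ S | f.discr = d}.encard ≤ {f ∈ S | f.discr = d'}.encard := by
    obtain ⟨c, rfl⟩ := exists_pow_mul_eq_of_quadraticChar_eq hgcd hd hd' h
    refine Set.encard_le_encard_of_injOn (f := scaleRootsMulEquiv c) ?_
      (scaleRootsMulEquiv c).injective.injOn
    rintro f ⟨hf, rfl⟩
    refine ⟨hscale f hf c, ?_⟩
    obtain ⟨hm, hn⟩ := hS hf
    exact hn ▸ hm.discr_scaleRoots (c : F)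
  exact (key hd hd' h).antisymm (key hd' hd h.symm)

omit [DecidableEq F] in
theorem finite_monicsOfDegree (m : ℕ) : (monicsOfDegree F m).Finite :=
  (monicFinset F m).finite_toSet.subset fun _ hf ↦ mem_monicFinset.2 hf

theorem discsEquallyDistributed_of_scaleRoots_mem {m : ℕ}
    (hgcd : Nat.gcd (Fintype.card F - 1) (m * (m - 1)) = 2)
    {S : Set F[X]} (hS : S ⊆ monicsOfDegree F m)
    (hscale : ∀ f ∈ S, ∀ c : Fˣ, f.scaleRoots (c : F) ∈ S) {ε : ℤ} (hε : ε ≠ 0)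
    (hdisc : ∀ f ∈ S, quadraticChar F f.discr = ε) :
    DiscsEquallyDistributed S {d : F | quadraticChar F d = ε} := by
  refine ⟨hdisc, ?_⟩
  rcases {d : F | quadraticChar F d = ε}.eq_empty_or_nonempty with h | ⟨d₀, hd₀⟩
  -- `ε` is an arbitrary nonzero integer here, so there may be no base point `d₀`.
  · exact ⟨0, fun d hd ↦ absurd (h ▸ hd) (Set.notMem_empty d)⟩
  have hne {d : F} (hd : quadraticChar F d = ε) : d ≠ 0 := fun h ↦
    hε (hd.symm.trans (quadraticChar_eq_zero_iff.2 h))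
  refine ⟨{f ∈ S | f.discr = d₀}.ncard, fun d hd ↦ ?_⟩
  rw [((finite_monicsOfDegree m).subset fun f hf ↦ hS hf.1).cast_ncard_eq]
  exact encard_discr_fiber_eq hgcd hS hscale (hne hd) (hne hd₀) (hd.trans hd₀.symm)

/-- A zero character sum makes the values `1` and `-1` equally frequent. It serves both for `discr`
on monics and for the identity on `F`. -/
theorem two_mul_card_filter_quadraticChar_eq {α : Type*} (T : Finset α) (g : α → F)
    (hsum : ∑ a ∈ T, quadraticChar F (g a) = 0) {ε : ℤ} (hε : ε = 1 ∨ ε = -1) :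
    2 * {a ∈ T | quadraticChar F (g a) = ε}.card = {a ∈ T | g a ≠ 0}.card := by
  have h1 : ∀ a ∈ T, quadraticChar F (g a) =
      (if quadraticChar F (g a) = 1 then 1 else 0) - (if quadraticChar F (g a) = -1 then 1 else 0) ∧
      (if g a ≠ 0 then (1 : ℤ) else 0) =
      (if quadraticChar F (g a) = 1 then 1 else 0) +
        (if quadraticChar F (g a) = -1 then 1 else 0) := by
    intro a _
    by_cases h : g a = 0
    · simp [h]
    · rcases quadraticChar_dichotomy h with h' | h' <;> simp [h, h']
  rw [Finset.sum_congr rfl fun a ha ↦ (h1 a ha).1, Finset.sum_sub_distrib] at hsum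
  have h2 := Finset.sum_congr rfl fun a ha ↦ (h1 a ha).2
  rw [Finset.sum_add_distrib] at h2
  simp only [← Nat.cast_one (R := ℤ), ← Nat.cast_zero (R := ℤ), ← Nat.cast_ite] at hsum h2
  simp only [← Nat.cast_sum, ← Finset.card_filter] at hsum h2
  simp only [Nat.cast_one] at hsum h2
  rcases hε with rfl | rfl <;> omega

theorem two_mul_card_quadraticChar_eq (hF : ringChar F ≠ 2) {ε : ℤ} (hε : ε = 1 ∨ ε = -1) :
    2 * {d : F | quadraticChar F d = ε}.ncard = Fintype.card F - 1 := by
  have h := two_mul_card_filter_quadraticChar_eq Finset.univ id (quadraticChar_sum_zero hF) hε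
  simp only [id] at h
  rw [Set.ncard_eq_toFinset_card', Set.toFinset_ofPred, h, Finset.filter_ne',
    Finset.card_erase_of_mem (Finset.mem_univ _), Finset.card_univ]

theorem encard_discr_fiber_monicsOfDegree (hF : ringChar F ≠ 2) {m : ℕ} (hm : 2 ≤ m)
    (hgcd : Nat.gcd (Fintype.card F - 1) (m * (m - 1)) = 2) (d : F) :
    {f ∈ monicsOfDegree F m | f.discr = d}.encard = ((Fintype.card F ^ (m - 1) : ℕ) : ℕ∞) := by
  classical
  have hset (d : F) : {f ∈ monicsOfDegree F m | f.discr = d} =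
      ({f ∈ monicFinset F m | f.discr = d} : Finset F[X]) := by
    ext f
    simp [mem_monicFinset, monicsOfDegree]
  have hsq : ({f ∈ monicFinset F m | f.discr ≠ 0} : Finset F[X]) =
      {f ∈ monicFinset F m | Squarefree f} := Finset.filter_congr fun f hf ↦
    discr_ne_zero_iff_squarefree (mem_monicFinset.1 hf).1
  have hcard := card_squarefree_monicFinset (F := F) m hm
  rw [← hsq] at hcard
  rw [hset, Set.encard_coe_eq_coe_finsetCard, Nat.cast_inj]
  by_cases hd : d = 0
  · have h := Finset.card_filter_add_card_filter_not (s := monicFinset F m) (fun f ↦ f.discr = 0)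
    rw [card_monicFinset] at h
    rw [hd]
    simp only [ne_eq] at hcard
    omega
  have hε : quadraticChar F d = 1 ∨ quadraticChar F d = -1 := quadraticChar_dichotomy hd
  have h1 := two_mul_card_filter_quadraticChar_eq (monicFinset F m) discr
    (sum_quadraticChar_discr hF m hm) hε
  have h2 := two_mul_card_quadraticChar_eq hF hε
  rw [Set.ncard_eq_toFinset_card', Set.toFinset_ofPred] at h2
  -- Fibres over the class of `d` all have the size of the fibre over `d`, so the class total is
  -- `(q-1)/2` times that size.
  have h3 := Finset.card_eq_sum_card_fiberwise (f := discr)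
    (s := {f ∈ monicFinset F m | quadraticChar F f.discr = quadraticChar F d})
    (t := {e : F | quadraticChar F e = quadraticChar F d}) fun f hf ↦ by
      simpa using (Finset.mem_filter.1 hf).2
  rw [Finset.sum_congr rfl (g := fun _ ↦ {f ∈ monicFinset F m | f.discr = d}.card),
    Finset.sum_const, smul_eq_mul] at h3
  · have hq : 1 < Fintype.card F := Fintype.one_lt_card
    obtain ⟨k, rfl⟩ := Nat.exists_eq_add_of_le' hm
    obtain ⟨r, hr⟩ := Nat.exists_eq_add_of_lt hq
    rw [h3, ← mul_assoc, h2] at h1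
    rw [← h1, show k + 2 - 1 = k + 1 from rfl, pow_succ _ (k + 1)] at hcard
    rw [show k + 2 - 1 = k + 1 from rfl]
    have h4 : Fintype.card F - 1 = r + 1 := by omega
    have h5 : Fintype.card F = r + 2 := by omega
    rw [h4, h5] at hcard
    rw [h5]
    refine Nat.eq_of_mul_eq_mul_left (Nat.succ_pos r) ?_
    linarith
  · intro e he
    have he' : quadraticChar F e = quadraticChar F d := (Finset.mem_filter.1 he).2
    have he0 : e ≠ 0 := fun h0 ↦ hd (by rwa [h0, quadraticChar_zero, eq_comm,
      quadraticChar_eq_zero_iff] at he')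
    have h4 := encard_discr_fiber_eq hgcd (S := monicsOfDegree F m) subset_rfl
      (fun f hf c ↦ ⟨(monic_scaleRoots_iff _).2 hf.1, (natDegree_scaleRoots _ _).trans hf.2⟩)
      he0 hd he'
    rw [hset, hset, Set.encard_coe_eq_coe_finsetCard, Set.encard_coe_eq_coe_finsetCard,
      Nat.cast_inj] at h4
    rw [← h4, Finset.filter_filter]
    congr 1
    refine Finset.filter_congr fun f _ ↦ ⟨fun h ↦ h.2, fun h ↦ ⟨by rw [h, he'], h⟩⟩

end

/-- The witness is the minimal polynomial of a primitive element of the degree `m` extension. -/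
theorem monicIrreduciblesOfDegree_nonempty (F : Type*) [Field F] [Finite F] {m : ℕ} (hm : m ≠ 0) :
    (monicIrreduciblesOfDegree F m).Nonempty := by
  obtain ⟨p, hp⟩ := CharP.exists F
  have : Fact p.Prime := ⟨CharP.char_is_prime F p⟩
  have : NeZero m := ⟨hm⟩
  let pb := Field.powerBasisOfFiniteOfSeparable F (FiniteField.Extension F p m)
  refine ⟨minpoly F pb.gen, minpoly.monic pb.isIntegral_gen, minpoly.irreducible pb.isIntegral_gen, ?_⟩
  rw [pb.natDegree_minpoly, ← pb.finrank, FiniteField.finrank_extension]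

theorem theorem1p1 {F : Type*} [Field F] [Fintype F] [DecidableEq F] (q m : ℕ)
    (hF : Fintype.card F = q) (hq : Odd q) (hm : 2 ≤ m)
    (hgcd : Nat.gcd (q - 1) (m * (m - 1)) = 2) :
    -- every element of `F` is the discriminant of exactly `q ^ (m - 1)` monics of degree `m`
    (∀ d : F, {f ∈ monicsOfDegree F m | f.discr = d}.encard = ((q ^ (m - 1) : ℕ) : ℕ∞)) ∧
    -- for either sign, exactly half of the nonzero elements have that quadratic character
    (∀ k : ℕ, {d : F | quadraticChar F d = (-1) ^ k}.encard = (((q - 1) / 2 : ℕ) : ℕ∞)) ∧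
    -- monic irreducibles of degree `m`
    ((monicIrreduciblesOfDegree F m).Nonempty ∧
      DiscsEquallyDistributed (monicIrreduciblesOfDegree F m)
        {d : F | quadraticChar F d = (-1) ^ (m - 1)}) ∧
    -- monic squarefree polynomials with a given factorization type
    (∀ lam : m.Partition, DiscsEquallyDistributed (monicsOfType F lam)
        {d : F | quadraticChar F d = (-1) ^ (m - lam.parts.card)}) := by
  subst hF
  have hchar : ringChar F ≠ 2 := fun h ↦
    (Nat.not_even_iff_odd.2 hq) (Nat.even_iff.2 (FiniteField.even_card_iff_char_two.1 h))
  refine ⟨encard_discr_fiber_monicsOfDegree hchar hm hgcd, fun k ↦ ?_,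
    ⟨monicIrreduciblesOfDegree_nonempty F (by omega), ?_⟩, fun lam ↦ ?_⟩
  · rw [← (Set.toFinite _).cast_ncard_eq, Nat.cast_inj,
      ← two_mul_card_quadraticChar_eq hchar (neg_one_pow_eq_or ℤ k)]
    omega
  · refine discsEquallyDistributed_of_scaleRoots_mem hgcd (fun f hf ↦ ⟨hf.1, hf.2.2⟩) ?_
      (pow_ne_zero _ (by norm_num)) fun f hf ↦ ?_
    · exact fun f hf c ↦ ⟨(monic_scaleRoots_iff _).2 hf.1, hf.2.1.scaleRoots c,
        (natDegree_scaleRoots _ _).trans hf.2.2⟩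
    · rw [quadraticChar_discr_of_irreducible hchar hf.1 hf.2.1, hf.2.2]
  · refine discsEquallyDistributed_of_scaleRoots_mem hgcd
      (fun f hf ↦ ⟨hf.1, hf.2.2.natDegree_eq⟩) ?_ (pow_ne_zero _ (by norm_num)) fun f hf ↦ ?_
    · intro f hf c
      have h := hf.2.2.scaleRoots c
      exact ⟨h.monic, h.squarefree, h⟩
    · have hn := hf.2.2.natDegree_eq
      obtain ⟨s, hs, rfl, hlam⟩ := hf.2.2
      -- With `ℓ ≤ m` the subtraction `m - ℓ` is not truncated, so it has the parity of `m + ℓ`.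
      have hle := lam.card_parts_le
      rw [quadraticChar_discr_prod hchar s hs, hn, ← hlam, Multiset.card_map, Finset.card_val,
        neg_one_pow_congr]
      rw [← hlam, Multiset.card_map, Finset.card_val] at hle
      simp only [Nat.even_iff]
      omega
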